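/- Let $\mathbb F_q\subseteq\mathbb F_{q^m}$ be finite fields of characteristic $2$, and let $x\in\mathbb F_{q^m}^n$ have pairwise distinct entries. For $y\in(\mathbb F_{q^m}^{*})^n$ put $\mathrm{GRS}_r(x,y)=\{(y_iP(x_i))_{1\le i\le n} : P\in\mathbb F_{q^m}[z],\ \deg P<r\}$; the alternant code of degree $r$ and extension degree $m$ is $\mathcal A_r(x,y)=\mathrm{GRS}_r(x,y)^{\perp}\cap\mathbb F_q^n$. For $\Gamma\in\mathbb F_{q^m}[z]$ of degree $r$ with $\Gamma(x_i)\neq0$ for all $i$, the Goppa code is $\mathcal G(x,\Gamma)=\mathcal A_r\big(x,(1/\Gamma(x_i))_i\big)$; it is binary if $q=2$. For a code $\mathcal C\subseteq\mathbb F_q^n$ let $\mathcal D$ be the $\mathbb F_{q^m}$-linear span of $\mathcal C^\perp$ in $\mathbb F_{q^m}^n$ (the extended dual), and let $v_1,\dots,v_s$ be any basis of $\mathcal D$. With $\star$ the componentwise product, the matrix code of quadratic relations $\mathcal C_{\mathrm{mat}}$ is the space of all symmetric $s\times s$ matrices $M_c$ over $\mathbb F_{q^m}$ with entries $(M_c)_{i,j}=(M_c)_{j,i}=c_{i,j}$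 for $i<j$ and $(M_c)_{i,i}=2c_{i,i}=0$, where $c=(c_{i,j})_{1\le i\le j\le s}$ runs through the solutions of $\sum_{i\le j}c_{i,j}\,v_i\star v_j=0$. In the polynomial ring $\mathbb F_{q^m}[m_{i,j}:1\le i<j\le s]$ let $$\mathcal P_2^+(M)=\big\langle m_{i,j}m_{k,l}+m_{i,k}m_{j,l}+m_{i,l}m_{j,k} : 1\le i<j<k<l\le s\big\rangle+\langle L\rangle,$$ where $L$ runs through the linear forms $\sum_{i<j}a_{i,j}m_{i,j}$, $a_{i,j}\in\mathbb F_{q^m}$, that vanish on $\mathcal C_{\mathrm{mat}}$. Let $\mathbf V(\mathcal P_2^+(M))$ be its zero set over the algebraic closure $\overline{\mathbb F_{q^m}}$, and let $\dim$ denote the dimension of an affine algebraic set (the Krull dimension of its coordinate ring). Then: 1. If $\mathcal C=\mathcal A_r(x,y)$ is an alternant code with $\dim_{\mathbb F_q}\mathcal C=n-rm$, then $\dim\mathbf V(\mathcal P_2^+(M))\ge r-2$. 2. If $q=2$ and $\mathcal C=\mathcal G(x,\Gamma)$ is a binary Goppa code with $\Gamma$ square-free of degree $r$ and $\dim_{\mathbb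 F_2}\mathcal C=n-rm$, then $\dim\mathbf V(\mathcal P_2^+(M))\ge 2r-3$. -/

import Mathlib

open scoped Polynomial

noncomputable section

namespace CodeRelations

section Codes

/-- The generalized Reed-Solomon code with support `x` and multiplier `y`:
all vectors `(y₁ P(x₁), …, yₙ P(xₙ))` with `deg P < r`. -/
def grs {F : Type*} [Field F] {n : ℕ} (r : ℕ) (x y : Fin n → F) : Submodule F (Fin n → F) :=
  (Polynomial.degreeLT F r).map
    (LinearMap.pi (fun i => y i • Polynomial.leval (x i)) : F[X] →ₗ[F] (Fin n → F))

/-- The dual code with respect to the standard scalar product. -/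
def dualCode {F : Type*} [Field F] {n : ℕ} (C : Submodule F (Fin n → F)) :
    Submodule F (Fin n → F) where
  carrier := {d | ∀ c ∈ C, ∑ i, c i * d i = 0}
  zero_mem' := by
    intro c _
    simp
  add_mem' := by
    intro a b ha hb c hc
    simp [mul_add, Finset.sum_add_distrib, ha c hc, hb c hc]
  smul_mem' := by
    intro t a ha c hc
    have h : ∑ i, c i * (t • a) i = t * ∑ i, c i * a i := by
      rw [Finset.mul_sum]
      refine Finset.sum_congr rfl fun i _ => ?_
      simp only [Pi.smul_apply, smul_eq_mul]
      ring
    rw [h, ha c hc, mul_zero]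

/-- The alternant code over `K` of degree `r`: the vectors with entries in the subfield `K` that
lie in the dual of the GRS code over `L`. -/
def alternant (K : Type*) {L : Type*} [Field K] [Field L] [Algebra K L] {n : ℕ} (r : ℕ)
    (x y : Fin n → L) : Submodule K (Fin n → K) :=
  ((dualCode (grs r x y)).restrictScalars K).comap ((Algebra.linearMap K L).compLeft (Fin n))

/-- The Goppa code over `K` with support `x` and Goppa polynomial `Γ`: the alternant code of
degree `deg Γ` with multiplier `1 / Γ(x)`. -/
def goppa (K : Type*) {L : Type*} [Field K] [Field L] [Algebra K L] {n : ℕ}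
    (x : Fin n → L) (Γ : L[X]) : Submodule K (Fin n → K) :=
  alternant K Γ.natDegree x (fun i => (Γ.eval (x i))⁻¹)

/-- The extension of a code over `K` to the field `L`: its `L`-linear span in `Lⁿ`. -/
def extendCode {K : Type*} (L : Type*) [Field K] [Field L] [Algebra K L] {n : ℕ}
    (C : Submodule K (Fin n → K)) : Submodule L (Fin n → L) :=
  Submodule.span L ((fun c : Fin n → K => fun i => algebraMap K L (c i)) '' (C : Set (Fin n → K)))

end Codes

section Relations

variable {F : Type*} [Field F] {n s : ℕ}

/-- The code of relations between the Schur (componentwise) products of the vectors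
`v₁, …, vₛ`: the families `(c_{i,j})_{i ≤ j}` with `∑_{i ≤ j} c_{i,j} vᵢ ⋆ vⱼ = 0`. -/
def relCode (v : Fin s → Fin n → F) :
    Submodule F ({p : Fin s × Fin s // p.1 ≤ p.2} → F) where
  carrier := {c | ∑ p, c p • (v p.1.1 * v p.1.2) = 0}
  zero_mem' := by simp
  add_mem' := by
    intro a b ha hb
    simp only [Set.mem_ofPred_eq] at ha hb ⊢
    simp [add_smul, Finset.sum_add_distrib, ha, hb]
  smul_mem' := by
    intro t a ha
    simp only [Set.mem_ofPred_eq] at ha ⊢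
    simp [mul_smul, ← Finset.smul_sum, ha]

/-- The symmetric matrix of the polar form of the quadratic form `∑_{i ≤ j} c_{i,j} xᵢ xⱼ`:
off-diagonal entries `c_{i,j}`, diagonal entries `2 c_{i,i}`. -/
def polarMatrix : ({p : Fin s × Fin s // p.1 ≤ p.2} → F) →ₗ[F] Matrix (Fin s) (Fin s) F where
  toFun c := Matrix.of fun i j =>
    if h : i < j then c ⟨(i, j), h.le⟩
    else if h' : j < i then c ⟨(j, i), h'.le⟩
    else 2 * c ⟨(i, i), le_rfl⟩
  map_add' a b := by
    ext i j
    simp only [Matrix.of_apply, Matrix.add_apply, Pi.add_apply]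
    split_ifs <;> ring
  map_smul' t a := by
    ext i j
    simp only [Matrix.of_apply, Matrix.smul_apply, Pi.smul_apply, smul_eq_mul, RingHom.id_apply]
    split_ifs <;> ring

/-- The matrix code of quadratic relations between the vectors `v₁, …, vₛ`. -/
def matCode (v : Fin s → Fin n → F) : Submodule F (Matrix (Fin s) (Fin s) F) :=
  (relCode v).map polarMatrix

end Relations

section Pfaffian

/-- The indices of the independent entries `m_{i,j}`, `i < j`, of a skew-symmetric matrix. -/
abbrev SkewIndex (s : ℕ) : Type := {p : Fin s × Fin s // p.1 < p.2}

/-- The generic skew-symmetric matrix in characteristic 2: zero diagonal, and `m_{j,i}` with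
`i < j` is an alias of the variable `m_{i,j}`. -/
def genericSkew (F : Type*) [Field F] (s : ℕ) :
    Matrix (Fin s) (Fin s) (MvPolynomial (SkewIndex s) F) :=
  Matrix.of fun i j =>
    if h : i < j then MvPolynomial.X ⟨(i, j), h⟩
    else if h' : j < i then MvPolynomial.X ⟨(j, i), h'⟩
    else 0

/-- The Pfaffian ideal of rank 2 of the generic `s × s` skew-symmetric matrix in
characteristic 2. -/
def pfaffianIdeal (F : Type*) [Field F] (s : ℕ) : Ideal (MvPolynomial (SkewIndex s) F) :=
  Ideal.span {f | ∃ i j k l : Fin s, i < j ∧ j < k ∧ k < l ∧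
    f = genericSkew F s i j * genericSkew F s k l + genericSkew F s i k * genericSkew F s j l
      + genericSkew F s i l * genericSkew F s j k}

/-- The ideal generated by the linear forms `∑_{i < j} a_{i,j} m_{i,j}` that vanish on every
matrix of `D`. -/
def linearIdeal {F : Type*} [Field F] {s : ℕ} (D : Submodule F (Matrix (Fin s) (Fin s) F)) :
    Ideal (MvPolynomial (SkewIndex s) F) :=
  Ideal.span {f | ∃ a : SkewIndex s → F,
    (∀ M ∈ D, ∑ p, a p * M p.1.1 p.1.2 = 0) ∧
    f = ∑ p, MvPolynomial.C (a p) * genericSkew F s p.1.1 p.1.2}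

/-- The ideal `𝒫₂⁺(M)` attached to a matrix code `D` of skew-symmetric matrices: the Pfaffian
ideal together with the linear equations of `D`. -/
def pfaffianIdealPlus {F : Type*} [Field F] {s : ℕ}
    (D : Submodule F (Matrix (Fin s) (Fin s) F)) : Ideal (MvPolynomial (SkewIndex s) F) :=
  pfaffianIdeal F s ⊔ linearIdeal D

end Pfaffian

/-- The variety of an ideal of `F[z]`, as a set of points over the algebraic closure of `F`. -/
def variety {F : Type*} [Field F] {σ : Type*} (I : Ideal (MvPolynomial σ F)) :
    Set (σ → AlgebraicClosure F) :=
  MvPolynomial.zeroLocus (AlgebraicClosure F) I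

/-- The dimension of an algebraic subset `V` of affine space over the field `k`: the Krull
dimension of its coordinate ring `k[z] / I(V)`. -/
def affineDim {k : Type*} [Field k] {σ : Type*} (V : Set (σ → k)) : WithBot ℕ∞ :=
  ringKrullDim (MvPolynomial σ k ⧸ MvPolynomial.vanishingIdeal k V)

end CodeRelations

end

open CodeRelations

/-! The extended dual contains a GRS code, hence vectors `w_k = y x^k`. For coefficients `u_0, …,
u_{d-1}` put `f = ∑ u_a w_a` and `g = ∑ u_a w_{a+2}`. The matrix `f ∧ g` has rank at most 2, so its
Pfaffians vanish. It also satisfies the linear equations: the coefficient of `u_a u_b` comes from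
the relation `w_a w_{b+2} = w_b w_{a+2}`, that of `u_a^2` from `w_a w_{a+2} = w_{a+1}^2`, whose
square has zero polar form in characteristic 2. The entries of `f ∧ g` generate all products `u_a
u_b`, so the polynomial ring in the `u_a` is integral over the coordinate ring of the variety, whose
dimension is therefore at least `d` (`le_affineDim_of_shift_relations`). GRS dimension `r` gives `d
= r - 2`. In the binary square-free Goppa case, `goppa_le_alternant_sq` supplies GRS dimension `2r`,
hence `2r - 2` when `m ≥ 2`; for `m = 1` at most two support points exist and the few cases are
treated by hand. -/

noncomputable section

namespace CodeRelations

/-! ### Lower bounds for dimension from parametrizations. -/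

/-- Incomparability: the Krull dimension does not go up along an integral ring homomorphism. -/
theorem ringKrullDim_le_of_isIntegral {R S : Type*} [CommRing R] [CommRing S] (f : R →+* S)
    (hf : f.IsIntegral) : ringKrullDim S ≤ ringKrullDim R := by
  let _ : Algebra R S := f.toAlgebra
  have : Algebra.IsIntegral R S := ⟨hf⟩
  refine Order.krullDim_le_of_strictMono (PrimeSpectrum.comap f) ?_
  intro I J hIJ
  exact Ideal.IsIntegral.comap_lt_comap (R := R) hIJ

/-- If the polynomial map with components `P` sends the points of affine `d`-space into `V`, and
if the polynomial ring in `d` variables is generated by square roots of polynomials in the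
components, then `V` has dimension at least `d`. -/
theorem le_affineDim_of_param {k σ : Type*} [Field k] [Infinite k] {d : ℕ} {V : Set (σ → k)}
    (P : σ → MvPolynomial (Fin d) k)
    (hV : ∀ u : Fin d → k, (fun i => MvPolynomial.eval u (P i)) ∈ V)
    (hP : ∀ a, (MvPolynomial.X a ^ 2 : MvPolynomial (Fin d) k) ∈
      Algebra.adjoin k (Set.range P)) :
    (d : WithBot ℕ∞) ≤ affineDim V := by
  have hker : ∀ p ∈ MvPolynomial.vanishingIdeal k V, MvPolynomial.aeval P p = 0 := by
    intro p hp
    refine MvPolynomial.funext fun u => ?_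
    have h := hp _ (hV u)
    rw [map_zero, ← h]
    change (MvPolynomial.aeval u) ((MvPolynomial.aeval P) p) = _
    rw [← AlgHom.comp_apply, MvPolynomial.comp_aeval]
    rfl
  -- Integrality alone suffices for the dimension inequality; the induced map need not be injective.
  have hint : (Ideal.Quotient.lift (MvPolynomial.vanishingIdeal k V)
      (MvPolynomial.aeval P).toRingHom hker).IsIntegral := by
    intro q
    induction q using MvPolynomial.induction_on with
    | C c =>
      convert RingHom.isIntegralElem_map _
        (x := Ideal.Quotient.mk (MvPolynomial.vanishingIdeal k V) (MvPolynomial.C c)) using 1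
      simp
    | add p q hp hq => exact hp.add _ hq
    | mul_X p a hp =>
      refine hp.mul _ ?_
      have h := hP a
      rw [Algebra.adjoin_range_eq_range_aeval] at h
      obtain ⟨z, hz⟩ := h
      refine ⟨Polynomial.X ^ 2 - Polynomial.C (Ideal.Quotient.mk _ z),
        Polynomial.monic_X_pow_sub_C _ two_ne_zero, ?_⟩
      simp only [Polynomial.eval₂_sub, Polynomial.eval₂_X_pow, Polynomial.eval₂_C,
        Ideal.Quotient.lift_mk]
      exact sub_eq_zero.2 hz.symm
  have h := ringKrullDim_le_of_isIntegral _ hint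
  rw [MvPolynomial.ringKrullDim_of_isNoetherianRing, ringKrullDim_eq_zero_of_field] at h
  simpa [affineDim] using h

/-! ### Rank-two skew-symmetric matrices in the variety. -/

/-- The matrix `p qᵀ + q pᵀ`, in characteristic 2 the skew-symmetric matrix `p ∧ q`. -/
def wedge {F : Type*} [Field F] {s : ℕ} (p q : Fin s → F) : Matrix (Fin s) (Fin s) F :=
  Matrix.of fun i j => p i * q j + p j * q i

/-- The linear combination of the rows of `W` with indeterminate coefficients. -/
def genericRow {F : Type*} (k : Type*) [Field F] [Field k] [Algebra F k] {d s : ℕ}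
    (W : Fin d → Fin s → F) (p : Fin s) : MvPolynomial (Fin d) k :=
  ∑ a, MvPolynomial.C (algebraMap F k (W a p)) * MvPolynomial.X a

theorem wedge_mem_zeroLocus_pfaffianIdeal {F : Type*} [Field F] [CharP F 2] {k : Type*} [Field k]
    [Algebra F k] {s : ℕ} (f g : Fin s → k) :
    (fun p : SkewIndex s => wedge f g p.1.1 p.1.2) ∈
      MvPolynomial.zeroLocus k (pfaffianIdeal F s) := by
  have := charP_of_injective_algebraMap (algebraMap F k).injective 2
  have h2 : (2 : k) = 0 := CharTwo.two_eq_zero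
  have key : ∀ i j : Fin s,
      MvPolynomial.aeval (fun p : SkewIndex s => wedge f g p.1.1 p.1.2) (genericSkew F s i j) =
        f i * g j + f j * g i := by
    intro i j
    simp only [genericSkew, Matrix.of_apply]
    split_ifs with h h'
    · simp [wedge]
    · simp only [wedge, MvPolynomial.aeval_X, Matrix.of_apply]
      ring
    · obtain rfl : i = j := le_antisymm (not_lt.1 h') (not_lt.1 h)
      rw [map_zero]
      linear_combination (-f i * g i) * h2
  rw [pfaffianIdeal, MvPolynomial.zeroLocus_span]
  rintro _ ⟨i, j, l, t, -, -, -, rfl⟩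
  simp only [map_add, map_mul, key]
  -- Each of the six monomials occurs twice in the expanded Pfaffian.
  linear_combination (f i * f j * g l * g t + f i * f l * g j * g t + f i * f t * g j * g l +
    f j * f l * g i * g t + f j * f t * g i * g l + f l * f t * g i * g j) * h2

theorem wedge_mem_zeroLocus_linearIdeal {F : Type*} [Field F] [CharP F 2] {k : Type*} [Field k]
    [Algebra F k] {d s : ℕ} {D : Submodule F (Matrix (Fin s) (Fin s) F)}
    {W Z : Fin d → Fin s → F} (hD : ∀ a, wedge (W a) (Z a) ∈ D)
    (hD' : ∀ a b, a ≠ b → wedge (W a) (Z b) + wedge (W b) (Z a) ∈ D) (u : Fin d → k) :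
    (fun p : SkewIndex s => wedge (fun i => ∑ a, algebraMap F k (W a i) * u a)
      (fun i => ∑ a, algebraMap F k (Z a i) * u a) p.1.1 p.1.2) ∈
      MvPolynomial.zeroLocus k (linearIdeal D) := by
  rw [linearIdeal, MvPolynomial.zeroLocus_span]
  rintro _ ⟨c, hc, rfl⟩
  -- The value of the linear form at the point is the quadratic form in `u` with coefficients `T`.
  -- Since `T` is alternating, the terms `(a, b)` and `(b, a)` cancel.
  set T : Fin d → Fin d → F := fun a b => ∑ p, c p * wedge (W a) (Z b) p.1.1 p.1.2 with hT
  have hTd : ∀ a, T a a = 0 := fun a => hc _ (hD a)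
  have hTs : ∀ a b, T a b + T b a = 0 := by
    intro a b
    by_cases hab : a = b
    · subst hab; simp [hTd]
    · have := hc _ (hD' a b hab)
      simpa only [Matrix.add_apply, mul_add, Finset.sum_add_distrib] using this
  have key : (∑ p : SkewIndex s, algebraMap F k (c p) *
      wedge (fun i => ∑ a, algebraMap F k (W a i) * u a)
        (fun i => ∑ a, algebraMap F k (Z a i) * u a) p.1.1 p.1.2) =
      ∑ ab : Fin d × Fin d, algebraMap F k (T ab.1 ab.2) * (u ab.1 * u ab.2) := by
    simp only [hT, map_sum, Finset.sum_mul]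
    rw [Finset.sum_comm]
    refine Finset.sum_congr rfl fun p _ => ?_
    simp only [wedge, Matrix.of_apply]
    rw [Finset.sum_mul_sum, Finset.sum_mul_sum, Fintype.sum_prod_type]
    simp only [← Finset.sum_add_distrib, Finset.mul_sum, map_mul, map_add]
    refine Finset.sum_congr rfl fun a _ => Finset.sum_congr rfl fun b _ => ?_
    ring
  have hskew : ∀ p : SkewIndex s, genericSkew F s p.1.1 p.1.2 = MvPolynomial.X p := by
    intro p
    simp [genericSkew, p.2]
  simp only [map_sum, map_mul, hskew, MvPolynomial.aeval_X, MvPolynomial.aeval_C]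
  rw [key]
  refine Finset.sum_involution (fun ab _ => ab.swap) ?_ ?_ (fun _ _ => Finset.mem_univ _)
    (fun ab _ => ab.swap_swap)
  · rintro ⟨a, b⟩ -
    have := congrArg (algebraMap F k) (hTs a b)
    rw [map_add, map_zero] at this
    simp only [Prod.swap_prod_mk]
    linear_combination u a * u b * this
  · rintro ⟨a, b⟩ - h heq
    obtain rfl : b = a := congrArg Prod.fst heq
    simp [hTd] at h

/-- If the generic combinations `f` of the rows of `W` and `g` of the rows of `Z` are such that
`f ∧ g` lies in the matrix code `D`, and if the coordinates of `f ∧ g` generate the squares of the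
variables, then the variety of `D` has dimension at least the number of variables. -/
theorem le_affineDim_of_wedge_mem {F : Type*} [Field F] [CharP F 2] {d s : ℕ}
    {D : Submodule F (Matrix (Fin s) (Fin s) F)}
    {W Z : Fin d → Fin s → F} (hD : ∀ a, wedge (W a) (Z a) ∈ D)
    (hD' : ∀ a b, a ≠ b → wedge (W a) (Z b) + wedge (W b) (Z a) ∈ D)
    (hX : ∀ (A : Subalgebra (AlgebraicClosure F) (MvPolynomial (Fin d) (AlgebraicClosure F))),
      (∀ i j, genericRow _ W i * genericRow _ Z j + genericRow _ W j * genericRow _ Z i ∈ A) →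
      ∀ a, MvPolynomial.X a ^ 2 ∈ A) :
    (d : WithBot ℕ∞) ≤ affineDim (variety (pfaffianIdealPlus D)) := by
  have := IsAlgClosed.instInfinite (K := AlgebraicClosure F)
  have := charP_of_injective_algebraMap (algebraMap F (AlgebraicClosure F)).injective 2
  refine le_affineDim_of_param (fun p : SkewIndex s =>
    genericRow _ W p.1.1 * genericRow _ Z p.1.2 + genericRow _ W p.1.2 * genericRow _ Z p.1.1)
    (fun u => ?_) (hX _ fun i j => ?_)
  · have h1 := wedge_mem_zeroLocus_pfaffianIdeal (F := F)
      (fun i => ∑ a, algebraMap F (AlgebraicClosure F) (W a i) * u a)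
      (fun i => ∑ a, algebraMap F (AlgebraicClosure F) (Z a i) * u a)
    have h2 := wedge_mem_zeroLocus_linearIdeal hD hD' u
    have h3 : pfaffianIdealPlus D ≤ MvPolynomial.vanishingIdeal F
        {fun p : SkewIndex s => wedge (fun i => ∑ a, algebraMap F _ (W a i) * u a)
          (fun i => ∑ a, algebraMap F (AlgebraicClosure F) (Z a i) * u a) p.1.1 p.1.2} :=
      sup_le (fun p hp => by rintro _ rfl; exact h1 p hp)
        (fun p hp => by rintro _ rfl; exact h2 p hp)
    intro p hp
    convert h3 hp _ rfl using 3
    ext p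
    simp [genericRow, wedge]
  · rcases lt_trichotomy i j with h | rfl | h
    · exact Algebra.subset_adjoin ⟨⟨(i, j), h⟩, rfl⟩
    · rw [CharTwo.add_self_eq_zero]
      exact zero_mem _
    · rw [add_comm]
      exact Algebra.subset_adjoin ⟨⟨(j, i), h⟩, rfl⟩

/-! ### From quadratic relations to the matrix code. -/

/-- The polar matrix of a quadratic relation given by an arbitrary square matrix. -/
theorem add_transpose_mem_matCode {F : Type*} [Field F] {n s : ℕ} {v : Fin s → Fin n → F}
    (c : Matrix (Fin s) (Fin s) F) (hc : ∑ i, ∑ j, c i j • (v i * v j) = 0) :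
    c + c.transpose ∈ matCode v := by
  -- The products commute, so the lower triangle folds onto the upper one. The diagonal is kept
  -- once, because `polarMatrix` doubles it.
  refine ⟨fun p => c p.1.1 p.1.2 + if p.1.1 = p.1.2 then 0 else c p.1.2 p.1.1, ?_, ?_⟩
  · change ∑ p : {p : Fin s × Fin s // p.1 ≤ p.2},
      (c p.1.1 p.1.2 + if p.1.1 = p.1.2 then 0 else c p.1.2 p.1.1) • (v p.1.1 * v p.1.2) = 0
    rw [← hc, ← Fintype.sum_prod_type' (f := fun i j => c i j • (v i * v j)),
      ← Finset.sum_filter_add_sum_filter_not Finset.univ (fun p : Fin s × Fin s => p.1 ≤ p.2)]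
    simp only [add_smul, Finset.sum_add_distrib]
    congr 1
    · exact (Finset.sum_subtype _ (by simp)
        (fun p : Fin s × Fin s => c p.1 p.2 • (v p.1 * v p.2))).symm
    · rw [← Finset.sum_subtype (Finset.univ.filter fun p : Fin s × Fin s => p.1 ≤ p.2) (by simp)
        (fun p : Fin s × Fin s => (if p.1 = p.2 then 0 else c p.2 p.1) • (v p.1 * v p.2))]
      simp only [ite_smul, zero_smul]
      rw [Finset.sum_ite, Finset.sum_const_zero, zero_add, Finset.filter_filter]
      refine Finset.sum_nbij' Prod.swap Prod.swap ?_ ?_ (by simp) (by simp) ?_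
      · rintro ⟨i, j⟩ h
        simp only [Finset.mem_filter, Finset.mem_univ, true_and, Prod.swap_prod_mk, not_le] at h ⊢
        exact lt_of_le_of_ne h.1 h.2
      · rintro ⟨i, j⟩ h
        simp only [Finset.mem_filter, Finset.mem_univ, true_and, Prod.swap_prod_mk, not_le] at h ⊢
        exact ⟨h.le, h.ne⟩
      · rintro ⟨i, j⟩ -
        simp [mul_comm]
  · ext i j
    simp only [polarMatrix, LinearMap.coe_mk, AddHom.coe_mk, Matrix.of_apply, Matrix.add_apply,
      Matrix.transpose_apply]
    split_ifs with h1 h2 h3 h4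
    · exact absurd h2 h1.ne
    · rfl
    · exact absurd h4 h3.ne
    · exact add_comm _ _
    · obtain rfl : i = j := le_antisymm (not_lt.1 h3) (not_lt.1 h1)
      ring


section Coordinates

variable {F : Type*} [Field F] {n s : ℕ} {D : Submodule F (Fin n → F)}

/-- The relation `ab + cd = 0` has coefficient matrix `a bᵀ + c dᵀ` in the basis `v`; adding its
transpose gives the two wedges. -/
theorem wedge_repr_mem_matCode [CharP F 2] (v : Module.Basis (Fin s) F D) {a b c d : D}
    (h : (a : Fin n → F) * b = c * d) :
    wedge (v.repr a) (v.repr b) + wedge (v.repr c) (v.repr d) ∈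
      matCode fun i => (v i : Fin n → F) := by
  have hsum : ∀ t : D, ∑ i, v.repr t i • (v i : Fin n → F) = t := by
    intro t
    have := congrArg (Submodule.subtype D) (v.sum_repr t)
    simpa only [map_sum, map_smul, Submodule.subtype_apply] using this
  have hprod : ∀ t u : D,
      ∑ i, ∑ j, (v.repr t i * v.repr u j) • ((v i : Fin n → F) * v j) = t * u := by
    intro t u
    conv_rhs => rw [← hsum t, ← hsum u, Finset.sum_mul_sum]
    simp only [smul_mul_smul_comm]
  have := add_transpose_mem_matCode (v := fun i => (v i : Fin n → F))
    (Matrix.of fun i j => v.repr a i * v.repr b j + v.repr c i * v.repr d j) (by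
      simp only [Matrix.of_apply, add_smul, Finset.sum_add_distrib, hprod, h]
      ext i
      exact CharTwo.add_self_eq_zero _)
  convert this using 1
  ext i j
  simp only [wedge, Matrix.add_apply, Matrix.of_apply, Matrix.transpose_apply]
  ring

/-- With functionals dual to the `w_a`, this reads off coordinates along the `w_a` although `v` is
an arbitrary basis. -/
theorem sum_mul_genericRow_repr {k : Type*} [Field k] [Algebra F k] {d : ℕ}
    (v : Module.Basis (Fin s) F D) (w : Fin d → D) (l : D →ₗ[F] F) :
    ∑ p, MvPolynomial.C (algebraMap F k (l (v p))) * genericRow k (fun a => v.repr (w a)) p =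
      ∑ a, MvPolynomial.C (algebraMap F k (l (w a))) * MvPolynomial.X a := by
  simp only [genericRow, Finset.mul_sum]
  rw [Finset.sum_comm]
  refine Finset.sum_congr rfl fun a _ => ?_
  have : l (w a) = ∑ p, v.repr (w a) p * l (v p) := by
    conv_lhs => rw [← v.sum_repr (w a)]
    simp only [map_sum, map_smul, smul_eq_mul]
  rw [this, map_sum, map_sum, Finset.sum_mul]
  refine Finset.sum_congr rfl fun p _ => ?_
  rw [map_mul, map_mul]
  ring

theorem exists_dual_family {ι V : Type*} [AddCommGroup V] [Module F V] [DecidableEq ι] {w : ι → V}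
    (hw : LinearIndependent F w) :
    ∃ l : ι → V →ₗ[F] F, ∀ i j, l i (w j) = if j = i then 1 else 0 := by
  obtain ⟨g, hg⟩ := LinearMap.exists_leftInverse_of_injective
    (Finsupp.linearCombination F w) (LinearMap.ker_eq_bot.2 hw)
  refine ⟨fun i => Finsupp.lapply i ∘ₗ g, fun i j => ?_⟩
  have := LinearMap.congr_fun hg (Finsupp.single j 1)
  simp only [LinearMap.comp_apply, Finsupp.linearCombination_single, one_smul,
    LinearMap.id_apply] at this
  rw [LinearMap.comp_apply, this, Finsupp.lapply_apply, Finsupp.single_apply]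

/-- Let `w₀, w₁, …` be linearly independent vectors of `D` such that
`w_a w_{b+e} = w_b w_{a+e}` and such that `w_a w_{a+e}` is the square of an element of `D`. Then the
points `(∑ uₐ wₐ) ∧ (∑ uₐ w_{a+e})` form a subset of the variety of `D` that is large enough to
give a lower bound for the dimension. -/
theorem le_affineDim_of_shift_relations [CharP F 2] (v : Module.Basis (Fin s) F D) {d e : ℕ}
    (he : 0 < e) (w : ℕ → Fin n → F) (hmem : ∀ i < d + e, w i ∈ D)
    (hw : LinearIndependent F (fun i : Fin (d + e) => w i))
    (hswap : ∀ a b, w a * w (b + e) = w b * w (a + e))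
    (hsq : ∀ a < d, ∃ h ∈ D, w a * w (a + e) = h * h) :
    (d : WithBot ℕ∞) ≤
      affineDim (variety (pfaffianIdealPlus (matCode fun i => (v i : Fin n → F)))) := by
  set k := AlgebraicClosure F
  let w' : Fin (d + e) → D := fun i => ⟨w i, hmem i i.2⟩
  have hw' : LinearIndependent F w' := LinearIndependent.of_comp D.subtype hw
  obtain ⟨l, hl⟩ := exists_dual_family hw'
  let lo : Fin d → Fin (d + e) := fun a => ⟨a, by omega⟩
  let hi : Fin d → Fin (d + e) := fun a => ⟨a + e, by omega⟩
  refine le_affineDim_of_wedge_mem (W := fun a => v.repr (w' (lo a)))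
    (Z := fun a => v.repr (w' (hi a))) (fun a => ?_) (fun a b _ => ?_) (fun A hA => ?_)
  · obtain ⟨h, hhD, hh⟩ := hsq a a.2
    have := wedge_repr_mem_matCode v (a := w' (lo a)) (b := w' (hi a)) (c := ⟨h, hhD⟩)
      (d := ⟨h, hhD⟩) hh
    convert this using 1
    ext i j
    simp only [wedge, Matrix.add_apply, Matrix.of_apply]
    -- The square contributes `h ∧ h = 0`.
    rw [mul_comm (v.repr ⟨h, hhD⟩ j), CharTwo.add_self_eq_zero, add_zero]
  · exact wedge_repr_mem_matCode v (hswap a b)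
  -- `U i` and `G i` are the coordinates along `w i` of the two generic vectors, extended by zero;
  -- `G` is `U` shifted by `e`.
  · let U : ℕ → MvPolynomial (Fin d) k := fun i => if h : i < d then MvPolynomial.X ⟨i, h⟩ else 0
    let G : ℕ → MvPolynomial (Fin d) k := fun i => if e ≤ i then U (i - e) else 0
    have hU : ∀ i : Fin (d + e), ∑ p, MvPolynomial.C (algebraMap F k (l i (v p))) *
        genericRow k (fun a => v.repr (w' (lo a))) p = U i := by
      intro i
      rw [sum_mul_genericRow_repr]
      simp only [hl, U]
      split_ifs with h
      · rw [Finset.sum_eq_single ⟨i, h⟩]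
        · simp [lo]
        · intro b _ hb
          rw [if_neg]
          · simp
          · intro hbi
            exact hb (Fin.ext (congrArg Fin.val hbi :))
        · simp
      · refine Finset.sum_eq_zero fun a _ => ?_
        rw [if_neg]
        · simp
        · intro hai
          have : (a : ℕ) = i := congrArg Fin.val hai
          omega
    have hG : ∀ i : Fin (d + e), ∑ p, MvPolynomial.C (algebraMap F k (l i (v p))) *
        genericRow k (fun a => v.repr (w' (hi a))) p = G i := by
      intro i
      rw [sum_mul_genericRow_repr]
      simp only [hl, G, U]
      split_ifs with h h'
      · rw [Finset.sum_eq_single ⟨i - e, h'⟩]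
        · rw [if_pos (Fin.ext (Nat.sub_add_cancel h))]
          simp
        · intro b _ hb
          rw [if_neg]
          · simp
          · intro hbi
            have : (b : ℕ) + e = i := congrArg Fin.val hbi
            exact hb (Fin.ext (Nat.eq_sub_of_add_eq this))
        · simp
      · omega
      · refine Finset.sum_eq_zero fun a _ => ?_
        rw [if_neg]
        · simp
        · intro hai
          have : (a : ℕ) + e = i := congrArg Fin.val hai
          omega
    have hUG : ∀ i j : Fin (d + e), U i * G j + U j * G i ∈ A := by
      intro i j
      rw [← hU i, ← hU j, ← hG i, ← hG j, Finset.sum_mul_sum, Finset.sum_mul_sum,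
        Finset.sum_comm (f := fun p q => MvPolynomial.C (algebraMap F k (l j (v p))) *
          genericRow k (fun a => v.repr (w' (lo a))) p *
          (MvPolynomial.C (algebraMap F k (l i (v q))) *
          genericRow k (fun a => v.repr (w' (hi a))) q)), ← Finset.sum_add_distrib]
      refine sum_mem fun p _ => ?_
      rw [← Finset.sum_add_distrib]
      refine sum_mem fun q _ => ?_
      have := mul_mem (A.algebraMap_mem (algebraMap F k (l i (v p)) * algebraMap F k (l j (v q))))
        (hA p q)
      convert this using 1
      rw [MvPolynomial.algebraMap_eq, map_mul]
      ring
    -- The entry at `(a, b + e)` is `U a * U b + U (b + e) * U (a - e)`. Its second product has a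
    -- smaller index `a - e`, and is absent when `a < e`; so induction on `a` applies.
    have hUU : ∀ a b, U a * U b ∈ A := by
      intro a
      induction a using Nat.strong_induction_on with
      | _ a ih =>
        intro b
        by_cases hab : a < d ∧ b < d
        · have h := hUG ⟨a, by omega⟩ ⟨b + e, by omega⟩
          have hGb : G (b + e) = U b := by simp [G]
          simp only [hGb] at h
          by_cases hae : e ≤ a
          · have hGa : G a = U (a - e) := if_pos hae
            rw [hGa, mul_comm (U (b + e))] at h
            simpa using sub_mem h (ih (a - e) (by omega) (b + e))
          · have hGa : G a = 0 := if_neg hae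
            simpa [hGa] using h
        · have : U a * U b = 0 := by
            rcases not_and_or.1 hab with h | h <;> simp [U, h]
          rw [this]
          exact zero_mem _
    intro a
    simpa [U, sq] using hUU a a

end Coordinates

/-- The zero matrix is always a point, so the dimension is not `⊥`. This covers the small degrees,
where the claimed bound is not positive. -/
theorem zero_le_affineDim_variety_pfaffianIdealPlus {F : Type*} [Field F] [CharP F 2] {n s : ℕ}
    {D : Submodule F (Fin n → F)} (v : Module.Basis (Fin s) F D) :
    (0 : WithBot ℕ∞) ≤
      affineDim (variety (pfaffianIdealPlus (matCode fun i => (v i : Fin n → F)))) := by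
  simpa using le_affineDim_of_wedge_mem (d := 0) (D := matCode fun i => (v i : Fin n → F))
    (W := Fin.elim0) (Z := Fin.elim0) Fin.rec0 Fin.rec0 fun _ _ a => a.elim0

/-! ### GRS codes and the shift by two. -/

section GRS

variable {L : Type*} [Field L] {n : ℕ}

theorem mem_grs_iff {r : ℕ} {x y g : Fin n → L} :
    g ∈ grs r x y ↔ ∃ P : L[X], P.degree < r ∧ ∀ i, g i = y i * P.eval (x i) := by
  simp only [grs, Submodule.mem_map, Polynomial.mem_degreeLT]
  refine exists_congr fun P => and_congr_right fun _ => ?_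
  rw [eq_comm, funext_iff]
  simp [Polynomial.leval_apply]

theorem monomial_mem_grs {r k : ℕ} (hk : k < r) (x y : Fin n → L) :
    (fun i => y i * x i ^ k) ∈ grs r x y :=
  mem_grs_iff.2 ⟨Polynomial.X ^ k, by
    rw [Polynomial.degree_X_pow]; exact_mod_cast hk, fun i => by simp⟩

theorem linearIndependent_monomials {r : ℕ} {x y : Fin n → L} (hx : Function.Injective x)
    (hy : ∀ i, y i ≠ 0) (hr : r ≤ n) :
    LinearIndependent L (fun k : Fin r => fun i => y i * x i ^ (k : ℕ)) := by
  rw [Fintype.linearIndependent_iff]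
  intro c hc
  let P : L[X] := ∑ k : Fin r, Polynomial.C (c k) * Polynomial.X ^ (k : ℕ)
  have hdeg : P.degree < r := Polynomial.degree_sum_fin_lt c
  have hP : P = 0 := by
    refine Polynomial.eq_zero_of_degree_lt_of_eval_index_eq_zero Finset.univ
      hx.injOn ?_ fun i _ => ?_
    · refine hdeg.trans_le ?_
      simpa using hr
    · have := congrFun hc i
      simp only [Finset.sum_apply, Pi.smul_apply, smul_eq_mul, Pi.zero_apply] at this
      have h2 : y i * P.eval (x i) = 0 := by
        rw [← this, Polynomial.eval_finsetSum, Finset.mul_sum]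
        refine Finset.sum_congr rfl fun k _ => ?_
        simp only [Polynomial.eval_mul, Polynomial.eval_C, Polynomial.eval_pow,
          Polynomial.eval_X]
        ring
      exact (mul_eq_zero.1 h2).resolve_left (hy i)
  intro k
  have := congrArg (fun Q : L[X] => Q.coeff k) hP
  simpa [P, Polynomial.finsetSum_coeff, Polynomial.coeff_C_mul, Polynomial.coeff_X_pow,
    Fin.val_inj] using this

/-- A code that contains a GRS code of dimension `r` has a variety of dimension at least
`r - 2`. -/
theorem le_affineDim_add_two_of_grs_le [CharP L 2] {s r : ℕ} {x y : Fin n → L}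
    (hx : Function.Injective x) (hy : ∀ i, y i ≠ 0) (hr : r ≤ n) {D : Submodule L (Fin n → L)}
    (hD : grs r x y ≤ D) (v : Module.Basis (Fin s) L D) :
    (r : WithBot ℕ∞) ≤
      affineDim (variety (pfaffianIdealPlus (matCode fun i => (v i : Fin n → L)))) + 2 := by
  rcases le_or_gt 2 r with h2 | h2
  · obtain ⟨d, rfl⟩ := Nat.exists_eq_add_of_le' h2
    have := le_affineDim_of_shift_relations (d := d) v two_pos
      (fun k i => y i * x i ^ k) (fun k hk => hD (monomial_mem_grs hk x y))
      (linearIndependent_monomials hx hy hr)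
      (fun a b => by ext i; simp only [Pi.mul_apply]; ring)
      (fun a ha => ⟨fun i => y i * x i ^ (a + 1), hD (monomial_mem_grs (by omega) x y), by
        ext i; simp only [Pi.mul_apply]; ring⟩)
    push_cast
    gcongr
  · have h0 := zero_le_affineDim_variety_pfaffianIdealPlus v
    calc (r : WithBot ℕ∞) ≤ 0 + 2 := by rw [zero_add]; exact_mod_cast h2.le
      _ ≤ _ := by gcongr

end GRS

/-! ### Parity checks over `L` and the extended dual. -/

section Extension

variable {K L : Type*} [Field K] [Field L] [Algebra K L] {n : ℕ}

/-- The vectors over `L` that are orthogonal to a code over `K` lie in the extended dual. -/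
theorem mem_extendCode_dualCode [FiniteDimensional K L] {C : Submodule K (Fin n → K)} {g : Fin n → L}
    (hg : ∀ c ∈ C, ∑ i, algebraMap K L (c i) * g i = 0) : g ∈ extendCode L (dualCode C) := by
  -- The `K`-coordinates of a parity check over `L` are parity checks over `K`.
  let b := Module.finBasis K L
  have hsum : g = ∑ j, b j • (fun i => algebraMap K L (b.repr (g i) j)) := by
    ext i
    conv_lhs => rw [← b.sum_repr (g i)]
    simp [Algebra.smul_def, mul_comm]
  rw [hsum]
  refine sum_mem fun j _ => Submodule.smul_mem _ _ (Submodule.subset_span ?_)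
  refine ⟨fun i => b.repr (g i) j, fun c hc => ?_, rfl⟩
  have := congrArg (fun t => b.repr t j) (hg c hc)
  simpa only [← Algebra.smul_def, map_sum, map_smul, Finsupp.finsetSum_apply, Finsupp.smul_apply,
    smul_eq_mul, map_zero, Finsupp.zero_apply] using this

theorem mem_alternant_iff {r : ℕ} {x y : Fin n → L} {c : Fin n → K} :
    c ∈ alternant K r x y ↔
      ∀ P : L[X], P.degree < r → ∑ i, algebraMap K L (c i) * (y i * P.eval (x i)) = 0 := by
  constructor
  · intro h P hP
    rw [← h _ (mem_grs_iff.2 ⟨P, hP, fun _ => rfl⟩)]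
    exact Finset.sum_congr rfl fun i _ => mul_comm _ _
  · intro h g hg
    obtain ⟨P, hP, hgP⟩ := mem_grs_iff.1 hg
    rw [← h P hP]
    refine Finset.sum_congr rfl fun i _ => ?_
    rw [hgP, mul_comm]
    rfl

theorem grs_le_extendCode_dualCode [FiniteDimensional K L] {C : Submodule K (Fin n → K)} {r : ℕ} {x y : Fin n → L}
    (hC : C ≤ alternant K r x y) : grs r x y ≤ extendCode L (dualCode C) := by
  intro g hg
  obtain ⟨P, hP, hgP⟩ := mem_grs_iff.1 hg
  refine mem_extendCode_dualCode fun c hc => ?_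
  simp only [hgP]
  exact mem_alternant_iff.1 (hC hc) P hP

end Extension

/-! ### The doubled degree of binary square-free Goppa codes. -/

section Goppa

/-- Over a finite field of characteristic 2 every polynomial is a square modulo a square-free
polynomial. -/
theorem exists_dvd_sub_sq {L : Type*} [Field L] [Finite L] [CharP L 2] {G : L[X]}
    (hG : Squarefree G) (P : L[X]) : ∃ a : L[X], a.degree < G.degree ∧ G ∣ P - a ^ 2 := by
  have hG0 := hG.ne_zero
  have : Module.Finite L (AdjoinRoot G) := (AdjoinRoot.powerBasis hG0).finite
  have : Finite (AdjoinRoot G) := Module.finite_of_finite L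
  -- As `G` is square-free, `L[z]/(G)` is reduced, so Frobenius is injective; the ring is finite, so
  -- it is also surjective.
  have hinj : Function.Injective (fun t : AdjoinRoot G => t ^ 2) := by
    intro t u htu
    obtain ⟨t, rfl⟩ := AdjoinRoot.mk_surjective t
    obtain ⟨u, rfl⟩ := AdjoinRoot.mk_surjective u
    simp only [← map_pow] at htu
    rw [AdjoinRoot.mk_eq_mk] at htu ⊢
    rw [← sub_pow_char] at htu
    exact hG.isRadical 2 _ htu
  obtain ⟨t, ht⟩ := Finite.surjective_of_injective hinj (AdjoinRoot.mk G P)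
  obtain ⟨a, rfl⟩ := AdjoinRoot.mk_surjective t
  refine ⟨a % G, Polynomial.degree_mod_lt _ hG0, ?_⟩
  have ha : AdjoinRoot.mk G (a % G) = AdjoinRoot.mk G a := by
    rw [AdjoinRoot.mk_eq_mk]
    exact ⟨-(a / G), by linear_combination EuclideanDomain.div_add_mod a G⟩
  rw [← AdjoinRoot.mk_eq_mk, map_pow, ha]
  exact ht.symm

/-- A binary Goppa code with a square-free Goppa polynomial `Γ` has the parity checks of the Goppa
code of `Γ ^ 2`. -/
theorem goppa_le_alternant_sq {K L : Type*} [Field K] [Field L] [Finite L] [Algebra K L]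
    (hK : Nat.card K = 2) [CharP L 2] {n : ℕ} {x : Fin n → L} {G : L[X]} (hG : Squarefree G)
    (hGx : ∀ i, G.eval (x i) ≠ 0) :
    goppa K x G ≤ alternant K (2 * G.natDegree) x (fun i => (G.eval (x i))⁻¹ ^ 2) := by
  have hsq : ∀ t : K, t ^ 2 = t := by
    have := Nat.finite_of_card_ne_zero (α := K) (by omega)
    have := Fintype.ofFinite K
    intro t
    rw [← hK, Nat.card_eq_fintype_card, FiniteField.pow_card]
  intro c hc
  rw [goppa, mem_alternant_iff] at hc
  rw [mem_alternant_iff]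
  intro P hP
  -- `P / G^2 = (a / G)^2 + b / G`: the second term is a parity check of degree below `deg G`, and
  -- the first is the square of one because `c_i^2 = c_i`.
  obtain ⟨a, ha, b, hab⟩ := exists_dvd_sub_sq hG P
  have hG0 := hG.ne_zero
  rw [Polynomial.degree_eq_natDegree hG0] at ha
  have hb : b.degree < G.natDegree := by
    by_cases hb0 : b = 0
    · simp [hb0]
    have h1 : (P - a ^ 2).degree < (2 * G.natDegree : ℕ) := by
      refine (Polynomial.degree_sub_le _ _).trans_lt (max_lt hP ?_)
      rw [Polynomial.degree_lt_iff_coeff_zero]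
      intro k hk
      by_cases ha0 : a = 0
      · simp [ha0]
      · rw [← Polynomial.natDegree_lt_iff_degree_lt ha0] at ha
        refine Polynomial.coeff_eq_zero_of_natDegree_lt ?_
        rw [Polynomial.natDegree_pow]
        omega
    rw [hab, ← Polynomial.natDegree_lt_iff_degree_lt (mul_ne_zero hG0 hb0),
      Polynomial.natDegree_mul hG0 hb0] at h1
    rw [← Polynomial.natDegree_lt_iff_degree_lt hb0]
    omega
  have h1 : (∑ i, algebraMap K L (c i) * ((G.eval (x i))⁻¹ * a.eval (x i))) ^ 2 = 0 := by
    rw [hc a ha, zero_pow two_ne_zero]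
  rw [sum_pow_char] at h1
  refine Eq.trans ?_ ((congrArg₂ (· + ·) h1 (hc b hb)).trans (add_zero 0))
  simp only [← Finset.sum_add_distrib]
  refine Finset.sum_congr rfl fun i _ => ?_
  have hPi : P.eval (x i) = a.eval (x i) ^ 2 + G.eval (x i) * b.eval (x i) := by
    have := congrArg (Polynomial.eval (x i)) hab
    simp only [Polynomial.eval_sub, Polynomial.eval_pow, Polynomial.eval_mul] at this
    linear_combination this
  rw [hPi, mul_pow, ← map_pow, hsq]
  field_simp [hGx i]

end Goppa


/-- Over the field with two elements, a code of length at least two that contains a GRS code of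
dimension 2 has a variety of positive dimension. -/
theorem one_le_affineDim_of_grs_two_le {L : Type*} [Field L] [CharP L 2] (hL : ∀ t : L, t ^ 2 = t)
    {n s : ℕ} {x y : Fin n → L} (hx : Function.Injective x) (hy : ∀ i, y i ≠ 0) (hn : 2 ≤ n)
    {D : Submodule L (Fin n → L)} (hD : grs 2 x y ≤ D) (v : Module.Basis (Fin s) L D) :
    1 ≤ affineDim (variety (pfaffianIdealPlus (matCode fun i => (v i : Fin n → L)))) := by
  -- A shift by one suffices here: `w_0 w_1 = y^2 x = (y x)^2`, since `x^2 = x`.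
  have := le_affineDim_of_shift_relations (d := 1) v one_pos
    (fun k i => y i * x i ^ k) (fun k hk => hD (monomial_mem_grs hk x y))
    (linearIndependent_monomials hx hy hn)
    (fun a b => by ext i; simp only [Pi.mul_apply]; ring)
    (fun a ha => ⟨fun i => y i * x i ^ 1, hD (monomial_mem_grs one_lt_two x y), by
      obtain rfl : a = 0 := by omega
      ext i
      simp only [Pi.mul_apply, pow_zero, zero_add, pow_one]
      linear_combination -y i ^ 2 * hL (x i)⟩)
  simpa using this

end CodeRelations

end

/-! ### Assembly of both bounds. -/

theorem mainTheorem9 {K L : Type*} [Field K] [Finite K] [Field L] [Algebra K L]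
    [FiniteDimensional K L] (m : ℕ) (hm : Module.finrank K L = m)
    (n : ℕ) (x : Fin n → L) (hx : Function.Injective x) :
    -- alternant codes over a finite field of characteristic 2
    (CharP K 2 → ∀ (r : ℕ) (y : Fin n → L), (∀ i, y i ≠ 0) →
      Module.finrank K (alternant K r x y) + r * m = n →
      ∀ (s : ℕ) (v : Module.Basis (Fin s) L (extendCode L (dualCode (alternant K r x y)))),
        (r : WithBot ℕ∞) ≤
          affineDim (variety (pfaffianIdealPlus (matCode fun i => (v i : Fin n → L)))) + 2) ∧
    -- binary Goppa codes with a square-free Goppa polynomial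
    (Nat.card K = 2 → ∀ (r : ℕ) (Γ : Polynomial L), Γ.natDegree = r → Squarefree Γ →
      (∀ i, Γ.eval (x i) ≠ 0) →
      Module.finrank K (goppa K x Γ) + r * m = n →
      ∀ (s : ℕ) (v : Module.Basis (Fin s) L (extendCode L (dualCode (goppa K x Γ)))),
        ((2 * r : ℕ) : WithBot ℕ∞) ≤
          affineDim (variety (pfaffianIdealPlus (matCode fun i => (v i : Fin n → L)))) + 3) := by
  have hm0 : 0 < m := hm ▸ Module.finrank_pos
  constructor
  · intro hK r y hy hdim s v
    have := charP_of_injective_algebraMap (algebraMap K L).injective 2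
    -- The dimension hypothesis gives `r m ≤ n`; it serves to make the monomial vectors linearly
    -- independent.
    have hr : r ≤ n := (Nat.le_mul_of_pos_right r hm0).trans (by omega)
    exact le_affineDim_add_two_of_grs_le hx hy hr (grs_le_extendCode_dualCode le_rfl) v
  · rintro hK r Γ rfl hΓ hΓx hdim s v
    have := Fintype.ofFinite K
    have : CharP K 2 := charP_of_card_eq_prime (by rw [← Nat.card_eq_fintype_card, hK])
    have := charP_of_injective_algebraMap (algebraMap K L).injective 2
    have : Finite L := Module.finite_of_finite K
    have hy : ∀ i, (Γ.eval (x i))⁻¹ ≠ 0 := fun i => inv_ne_zero (hΓx i)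
    rcases le_or_gt 2 m with h2 | h2
    -- For `m ≥ 2`, `2r ≤ r m ≤ n`, and the stronger bound `2r - 2` holds.
    · have hr : 2 * Γ.natDegree ≤ n := by nlinarith
      have h := le_affineDim_add_two_of_grs_le hx (fun i => pow_ne_zero 2 (hy i)) hr
        (grs_le_extendCode_dualCode (goppa_le_alternant_sq hK hΓ hΓx)) v
      refine h.trans ?_
      gcongr
      exact_mod_cast Nat.le_succ 2
    -- Now `L` has two elements and `r ≤ n ≤ 2`. For `r = 2` the required dimension is 1, and the
    -- GRS code of dimension 2 provides it; for `r ≤ 1` the bound `2r - 3` is negative.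
    · obtain rfl : m = 1 := by omega
      have hL : Nat.card L = 2 := by
        rw [Module.natCard_eq_pow_finrank (K := K), hK, hm, pow_one]
      have hn : n ≤ 2 := by
        simpa [hL] using Nat.card_le_card_of_injective x hx
      rcases le_or_gt 2 Γ.natDegree with hr | hr
      · have hr2 : Γ.natDegree = 2 := by omega
        have hgrs : grs 2 x (fun i => (Γ.eval (x i))⁻¹) ≤ extendCode L (dualCode (goppa K x Γ)) :=
          grs_le_extendCode_dualCode (by rw [goppa, hr2])
        have hsq : ∀ t : L, t ^ 2 = t := by
          have := Fintype.ofFinite L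
          intro t
          rw [← hL, Nat.card_eq_fintype_card, FiniteField.pow_card]
        have h := one_le_affineDim_of_grs_two_le hsq hx hy (by omega) hgrs v
        calc ((2 * Γ.natDegree : ℕ) : WithBot ℕ∞) = 1 + 3 := by rw [hr2]; norm_num
          _ ≤ _ := by gcongr
      · have h0 := zero_le_affineDim_variety_pfaffianIdealPlus v
        calc ((2 * Γ.natDegree : ℕ) : WithBot ℕ∞) ≤ 0 + 3 := by
              rw [zero_add]; exact_mod_cast (by omega : 2 * Γ.natDegree ≤ 3)
          _ ≤ _ := by gcongr
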